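/- Let $G=(V,E)$ be a finite directed graph (parallel edges allowed) with $m=|E|$ edges, let $s,t\in V$, let $d\ge 0$, and let $U>0$. An $s$-$t$ flow of value $d$ is a vector $f\in\mathbb{R}_{\ge 0}^E$ whose net outflow is $0$ at every node other than $s,t$ and is $d$ at $s$; it is acyclic if the edges with $f_e>0$ contain no directed cycle. For delay functions $l=(l_e)_{e\in E}$ and tolls $\tau\in\mathbb{R}_{\ge 0}^E$, let $f(l,\tau)$ denote the (unique) acyclic Wardrop equilibrium, i.e. the acyclic $s$-$t$ flow $f$ of value $d$ such that for all $s$-$t$ paths $P,Q$ with $f_e>0$ for every $e\in P$, $$\sum_{e\in P}\bigl(l_e(f_e)+\tau_e\bigr)\le\sum_{e\in Q}\bigl(l_e(f_e)+\tau_e\bigr).$$ Tolls $\tau$ enforce $f^*$ if $f(l,\tau)=f^*$. Delay functions are called standard linear (with parameter $U$) if for every $e$ we have $l_e(x)=a_ex+b_e$ for $x\ge 0$, where $a_e>0$ and $a_e,b_e$ are multiples of $1/U$ in $[0,U]$. There is an absolute constant $C$ such that the following holds for all such $G,s,t,d,U$ and every acyclic $s$-$t$ flow $f^*$ of value $d$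 all of whose entries are multiples of $1/U$ in $[0,U]$. There is a deterministic adaptive query algorithm (which may depend on $G,s,t,d,U,f^*$, but not on the delay functions), each of whose queries is a toll vector $\tau\in\mathbb{R}_{\ge 0}^E$ that is answered by the equilibrium flow $f(l^*,\tau)$, such that for all standard linear delay functions $l^*$ (with parameter $U$) the algorithm outputs tolls $\tau^*\in\mathbb{R}_{\ge 0}^E$ that enforce $f^*$, i.e. $f(l^*,\tau^*)=f^*$, after at most $$C\,m^2\log(3mU)$$ queries; that is, after $\tilde O(m^2)$ queries. -/

import Mathlib

open scoped NNReal

/-- A directed (multi)graph with node type `V` and edge type `E`; the edge `e` goes from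
`src e` to `tgt e`. Parallel edges are allowed. -/
structure Network (V E : Type*) where
  src : E → V
  tgt : E → V

namespace Network

variable {V E : Type*}

/-- `G.IsWalk u p v`: the list of edges `p` is a directed walk from `u` to `v`. -/
inductive IsWalk (G : Network V E) : V → List E → V → Prop
  | nil (v : V) : IsWalk G v [] v
  | cons (e : E) (p : List E) (v : V) (h : IsWalk G (G.tgt e) p v) :
      IsWalk G (G.src e) (e :: p) v

/-- `G.IsPath u p v`: `p` is a directed walk from `u` to `v` that repeats no node. -/
def IsPath (G : Network V E) (u : V) (p : List E) (v : V) : Prop :=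
  G.IsWalk u p v ∧ (u :: p.map G.tgt).Nodup

/-- The edges carrying positive flow contain no directed cycle. -/
def IsAcyclicFlow (G : Network V E) (f : E → ℝ) : Prop :=
  ∀ (v : V) (p : List E), G.IsWalk v p v → (∀ e ∈ p, 0 < f e) → p = []

/-- Flow leaving `v` minus flow entering `v`. -/
def netOutflow [Fintype E] [DecidableEq V] (G : Network V E) (f : E → ℝ) (v : V) : ℝ :=
  (∑ e with G.src e = v, f e) - ∑ e with G.tgt e = v, f e

/-- `f` is an `s`-`t` flow of value `d`. -/
structure IsFeasibleFlow [Fintype E] [DecidableEq V] (G : Network V E) (s t : V) (d : ℝ)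
    (f : E → ℝ) : Prop where
  nonneg : ∀ e, 0 ≤ f e
  conservation : ∀ v, v ≠ s → v ≠ t → G.netOutflow f v = 0
  value : G.netOutflow f s = d

/-- The delay along `p` under the flow `f` and the delay functions `l`. -/
def pathDelay (l : E → ℝ → ℝ) (f : E → ℝ) (p : List E) : ℝ :=
  (p.map fun e => l e (f e)).sum

/-- Wardrop equilibrium of the single-commodity routing game `(G, l, (s, t, d))`: a feasible
flow such that every `s`-`t` path all of whose edges carry flow is a shortest `s`-`t` path. -/
structure IsWardropEquilibrium [Fintype E] [DecidableEq V] (G : Network V E) (s t : V) (d : ℝ)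
    (l : E → ℝ → ℝ) (f : E → ℝ) : Prop where
  feasible : G.IsFeasibleFlow s t d f
  shortest : ∀ P Q : List E, G.IsPath s P t → G.IsPath s Q t → (∀ e ∈ P, 0 < f e) →
    pathDelay l f P ≤ pathDelay l f Q

/-- An acyclic Wardrop equilibrium. Acyclicity removes circulations that no `s`-`t` agent uses,
which the edge formulation of feasible flows would otherwise permit. -/
structure IsEquilibriumFlow [Fintype E] [DecidableEq V] (G : Network V E) (s t : V) (d : ℝ)
    (l : E → ℝ → ℝ) (f : E → ℝ) : Prop where
  wardrop : G.IsWardropEquilibrium s t d l f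
  acyclic : G.IsAcyclicFlow f

/-- Delay functions after imposing the tolls `τ`. -/
def tolled (l : E → ℝ → ℝ) (τ : E → ℝ≥0) : E → ℝ → ℝ :=
  fun e x => l e x + τ e

/-- The equilibrium flow `f(l, τ)`, that is, the (unique) acyclic Wardrop equilibrium of the
game with delay functions `l` and tolls `τ`. As a function of `τ` this is the oracle. -/
noncomputable def equilibriumFlow [Fintype E] [DecidableEq V] (G : Network V E) (s t : V) (d : ℝ)
    (l : E → ℝ → ℝ) (τ : E → ℝ≥0) : E → ℝ :=
  Classical.epsilon fun f => G.IsEquilibriumFlow s t d (tolled l τ) f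

/-- The tolls `τ` enforce `f`: the flow `f` is an equilibrium flow under `τ`, and it is the one
denoted by `f(l, τ)`. -/
def Enforces [Fintype E] [DecidableEq V] (G : Network V E) (s t : V) (d : ℝ)
    (l : E → ℝ → ℝ) (τ : E → ℝ≥0) (f : E → ℝ) : Prop :=
  G.IsEquilibriumFlow s t d (tolled l τ) f ∧ ∀ e, G.equilibriumFlow s t d l τ e = f e

end Network

/-- `x` is a (nonnegative integer) multiple of `1 / U` lying in `[0, U]`. -/
def IsGridValue (U x : ℝ) : Prop :=
  (∃ k : ℕ, x = k / U) ∧ 0 ≤ x ∧ x ≤ U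

/-- A standard linear delay function with parameter `U`: `x ↦ a x + b` on `[0, ∞)`, with `a > 0`,
and `a`, `b` multiples of `1 / U` in `[0, U]`. -/
def IsStandardLinear (U : ℝ) (l : ℝ → ℝ) : Prop :=
  ∃ a b : ℝ, 0 < a ∧ IsGridValue U a ∧ IsGridValue U b ∧ ∀ x, 0 ≤ x → l x = a * x + b

/-- A deterministic adaptive query algorithm: it either stops and outputs tolls, or it queries
nonnegative tolls and continues depending on the flow that is returned. -/
inductive TollAlgorithm (E : Type*)
  | output (τ : E → ℝ≥0) : TollAlgorithm E
  | query (τ : E → ℝ≥0) (next : (E → ℝ) → TollAlgorithm E) : TollAlgorithm E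

namespace TollAlgorithm

variable {E : Type*}

/-- The tolls output when queries are answered by `oracle`. -/
def result (oracle : (E → ℝ≥0) → E → ℝ) : TollAlgorithm E → (E → ℝ≥0)
  | output τ => τ
  | query τ next => result oracle (next (oracle τ))

/-- The number of queries made when they are answered by `oracle`. -/
def numQueries (oracle : (E → ℝ≥0) → E → ℝ) : TollAlgorithm E → ℕ
  | output _ => 0
  | query τ next => numQueries oracle (next (oracle τ)) + 1

end TollAlgorithm

/-!
The algorithm is a halving algorithm whose queries are centerpoints.

Since `fstar` is acyclic, there are edge costs `c₀`, as large as desired on every edge, for which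
`fstar` is a cheapest flow (`exists_costs_minimized_by`): take the differences of a potential that
strictly decreases along the edges carrying flow, truncated from below. Tolls enforce `fstar` as
soon as they raise the delays `w e = l e (fstar e)` to `c₀`, so only the vector `w` is unknown, and
the grid assumption leaves at most `(U ^ 2 + 1) ^ (2 * m)` candidates for it.

Suppose that the tolls `c₀ - c` are answered by a flow `f ≠ fstar`. The variational inequality for
`f` (`IsEquilibriumFlow.variational_inequality`), strict monotonicity of the delays and the
optimality of `fstar` for `c₀` give `0 < ∑ e, (w e - c e) * (fstar e - f e)`
(`cut_of_equilibrium`): the answer is the normal vector of a hyperplane through `c` which has `w`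
strictly on one side. If `c` is a centerpoint of the remaining candidates (`exists_centerpoint`, a
consequence of Helly's theorem), at most a fraction `m / (m + 1)` of them survives. Hence
`1 + (m + 1) * log (#candidates) = O(m ^ 2 * log (3 * m * U))` queries suffice.

That the oracle returns an equilibrium at all is `exists_isEquilibriumFlow`, proved by minimizing
Beckmann's potential; uniqueness of the equilibrium is not needed, since the output tolls have been
queried and the oracle's answer to them was `fstar`.
-/

namespace Network

variable {V E : Type*}

/-! ### Walks and paths -/

theorem IsWalk.append {G : Network V E} {u v w : V} {p q : List E} (hp : G.IsWalk u p v)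
    (hq : G.IsWalk v q w) : G.IsWalk u (p ++ q) w := by
  induction hp with
  | nil => exact hq
  | cons e p v _ ih => exact IsWalk.cons e _ _ (ih hq)

theorem isWalk_singleton (G : Network V E) (e : E) : G.IsWalk (G.src e) [e] (G.tgt e) :=
  IsWalk.cons e [] _ (IsWalk.nil _)

/-- A walk can be split at each node it visits. -/
theorem IsWalk.exists_split {G : Network V E} {u v x : V} {p : List E} (hp : G.IsWalk u p v)
    (hx : x ∈ u :: p.map G.tgt) :
    ∃ p₁ p₂, p = p₁ ++ p₂ ∧ G.IsWalk u p₁ x ∧ G.IsWalk x p₂ v ∧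
      (x :: p₂.map G.tgt).Sublist (u :: p.map G.tgt) := by
  induction hp with
  | nil v =>
    obtain rfl : x = v := by simpa using hx
    exact ⟨[], [], rfl, IsWalk.nil _, IsWalk.nil _, List.Sublist.refl _⟩
  | cons e p v h ih =>
    rcases List.mem_cons.1 hx with rfl | hx
    · exact ⟨[], e :: p, rfl, IsWalk.nil _, IsWalk.cons e p v h, List.Sublist.refl _⟩
    · obtain ⟨p₁, p₂, rfl, h₁, h₂, h₃⟩ := ih (by simpa using hx)
      exact ⟨e :: p₁, p₂, rfl, IsWalk.cons e p₁ _ h₁, h₂, by simpa using h₃.cons (G.src e)⟩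

theorem IsWalk.exists_isPath_sublist {G : Network V E} {u v : V} {p : List E}
    (hp : G.IsWalk u p v) : ∃ q, G.IsPath u q v ∧ q.Sublist p := by
  induction hp with
  | nil v => exact ⟨[], ⟨IsWalk.nil v, by simp⟩, List.Sublist.refl _⟩
  | cons e p v _ ih =>
    obtain ⟨q, ⟨hq, hnd⟩, hqp⟩ := ih
    by_cases hmem : G.src e ∈ G.tgt e :: q.map G.tgt
    · obtain ⟨q₁, q₂, rfl, -, h₂, h₃⟩ := hq.exists_split hmem
      -- if `q` returns to the source of `e`, its tail from there on is the required path
      exact ⟨q₂, ⟨h₂, hnd.sublist h₃⟩,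
        ((List.sublist_append_right q₁ q₂).trans hqp).cons e⟩
    · exact ⟨e :: q, ⟨IsWalk.cons e q v hq, by simpa using List.nodup_cons.2 ⟨hmem, hnd⟩⟩,
        hqp.cons_cons e⟩

theorem IsAcyclicFlow.isPath {G : Network V E} {f : E → ℝ} (hf : G.IsAcyclicFlow f) {u v : V}
    {p : List E} (hp : G.IsWalk u p v) (hpos : ∀ e ∈ p, 0 < f e) : G.IsPath u p v := by
  refine ⟨hp, ?_⟩
  induction hp with
  | nil v => simp
  | cons e p v h ih =>
    have hpos' := List.forall_mem_cons.1 hpos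
    rw [List.map_cons, List.nodup_cons]
    refine ⟨fun hmem => ?_, ih hpos'.2⟩
    obtain ⟨p₁, p₂, rfl, h₁, -, -⟩ := h.exists_split hmem
    have := hf _ _ (IsWalk.cons e p₁ _ h₁) (by
      intro e' he'
      rcases List.mem_cons.1 he' with rfl | he'
      · exact hpos'.1
      · exact hpos'.2 e' (List.mem_append_left _ he'))
    simp at this

section Flows

variable [DecidableEq V] [Fintype E] {G : Network V E} {s t : V} {d : ℝ}

/-! ### Existence of equilibria -/

theorem netOutflow_eq_sum (G : Network V E) (f : E → ℝ) (v : V) :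
    G.netOutflow f v =
      ∑ e, f e * ((if G.src e = v then 1 else 0) - if G.tgt e = v then 1 else 0) := by
  simp [netOutflow, Finset.sum_filter, mul_sub]

theorem sum_count_mul [DecidableEq E] (p : List E) (c : E → ℝ) :
    ∑ e, (p.count e : ℝ) * c e = (p.map c).sum := by
  induction p with
  | nil => simp
  | cons e p ih => simp [List.count_cons, add_mul, Finset.sum_add_distrib, ih, add_comm]

theorem IsWalk.netOutflow_count [DecidableEq E] {u v : V} {p : List E} (hp : G.IsWalk u p v)
    (x : V) : G.netOutflow (fun e => (p.count e : ℝ)) x =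
      (if u = x then 1 else 0) - if v = x then 1 else 0 := by
  rw [netOutflow_eq_sum, sum_count_mul]
  induction hp with
  | nil => simp
  | cons e p v _ ih => simp [ih]

/-- A minimizer of Beckmann's potential over the feasible flows is an acyclic Wardrop equilibrium:
moving a little flow from a flow-carrying walk `P` to a walk `Q` with the same ends does not
decrease the potential, so `P` is not longer than `Q`. For a cycle `P` and `Q = []` this
contradicts the positivity of delays. -/
theorem exists_isEquilibriumFlow {l : E → ℝ → ℝ} {a b : E → ℝ} (ha : ∀ e, 0 < a e)
    (hb : ∀ e, 0 ≤ b e) (hl : ∀ e x, 0 ≤ x → l e x = a e * x + b e) {g : E → ℝ}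
    (hg : G.IsFeasibleFlow s t d g) : ∃ f, G.IsEquilibriumFlow s t d l f := by
  classical
  let Φ : (E → ℝ) → ℝ := fun f => ∑ e, (a e / 2 * f e ^ 2 + b e * f e)
  have hΦ : Continuous Φ := by fun_prop
  have hclosed : IsClosed {f | G.IsFeasibleFlow s t d f} := by
    have : {f | G.IsFeasibleFlow s t d f} = {f | ∀ e, 0 ≤ f e} ∩
        ({f | ∀ v, v ≠ s → v ≠ t → G.netOutflow f v = 0} ∩ {f | G.netOutflow f s = d}) := by
      ext f
      exact ⟨fun h => ⟨h.nonneg, h.conservation, h.value⟩, fun h => ⟨h.1, h.2.1, h.2.2⟩⟩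
    have hcont : ∀ v, Continuous fun f : E → ℝ => G.netOutflow f v := fun v => by
      unfold netOutflow
      fun_prop
    rw [this]
    simp only [Set.ofPred_forall]
    refine (isClosed_iInter fun e => isClosed_le continuous_const (continuous_apply e)).inter
      ((isClosed_iInter fun v => isClosed_iInter fun _ => isClosed_iInter fun _ =>
        isClosed_eq (hcont v) continuous_const).inter (isClosed_eq (hcont s) continuous_const))
  have hcompact : IsCompact ({f | G.IsFeasibleFlow s t d f} ∩ {f | Φ f ≤ Φ g}) := by
    refine (isCompact_Icc (a := 0) (b := fun e => 2 * Φ g / a e + 1)).of_isClosed_subset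
      (hclosed.inter (isClosed_le hΦ continuous_const)) fun f hf => ⟨hf.1.nonneg, fun e => ?_⟩
    have hterm : ∀ e, 0 ≤ a e / 2 * f e ^ 2 + b e * f e := fun e =>
      add_nonneg (mul_nonneg (half_pos (ha e)).le (sq_nonneg _)) (mul_nonneg (hb e) (hf.1.nonneg e))
    have h₁ : a e / 2 * f e ^ 2 + b e * f e ≤ Φ g :=
      (Finset.single_le_sum (fun e _ => hterm e) (Finset.mem_univ e)).trans hf.2
    have h₂ : f e ^ 2 ≤ 2 * Φ g / a e := by
      rw [le_div_iff₀ (ha e)]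
      nlinarith [mul_nonneg (hb e) (hf.1.nonneg e)]
    show f e ≤ 2 * Φ g / a e + 1
    nlinarith [sq_nonneg (f e - 1)]
  obtain ⟨f, ⟨hf, hfg⟩, hmin⟩ := hcompact.exists_isMinOn ⟨g, hg, le_refl (Φ g)⟩ hΦ.continuousOn
  have hmin' : ∀ h, G.IsFeasibleFlow s t d h → Φ f ≤ Φ h := fun h hh => by
    by_cases hle : Φ h ≤ Φ g
    · exact hmin ⟨hh, hle⟩
    · exact hfg.trans (not_le.1 hle).le
  have key : ∀ (u v : V) (P Q : List E), G.IsWalk u P v → G.IsWalk u Q v → (∀ e ∈ P, 0 < f e) →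
      pathDelay l f P ≤ pathDelay l f Q := by
    intro u v P Q hP hQ hpos
    let δ : E → ℝ := fun e => (Q.count e : ℝ) - P.count e
    have hnet : ∀ x, G.netOutflow δ x = 0 := fun x => by
      have h₁ := hP.netOutflow_count x
      have h₂ := hQ.netOutflow_count x
      rw [netOutflow_eq_sum] at h₁ h₂ ⊢
      simp only [δ, sub_mul, Finset.sum_sub_distrib] at h₁ h₂ ⊢
      linarith
    have hnonneg : ∀ᶠ ε in nhdsWithin (0 : ℝ) (Set.Ioi 0), ∀ e, 0 ≤ f e + ε * δ e := by
      refine Filter.eventually_all.2 fun e => ?_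
      by_cases he : e ∈ P
      · have : Filter.Tendsto (fun ε : ℝ => f e + ε * δ e) (nhds 0) (nhds (f e + 0 * δ e)) :=
          (by fun_prop : Continuous fun ε : ℝ => f e + ε * δ e).tendsto 0
        rw [zero_mul, add_zero] at this
        exact ((this.eventually (lt_mem_nhds (hpos e he))).filter_mono nhdsWithin_le_nhds).mono
          fun _ h => h.le
      · filter_upwards [self_mem_nhdsWithin] with ε hε
        have : 0 ≤ δ e := by simp [δ, List.count_eq_zero_of_not_mem he]
        exact add_nonneg (hf.nonneg e) (mul_nonneg (le_of_lt hε) this)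
    set c₁ := ∑ e, (a e * f e + b e) * δ e with hc₁
    set c₂ := ∑ e, a e / 2 * δ e ^ 2 with hc₂
    have hc₁nn : 0 ≤ c₁ := by
      have hev : ∀ᶠ ε in nhdsWithin (0 : ℝ) (Set.Ioi 0), 0 ≤ c₁ + ε * c₂ := by
        filter_upwards [hnonneg, self_mem_nhdsWithin] with ε hε (hε0 : 0 < ε)
        have hfeas : G.IsFeasibleFlow s t d fun e => f e + ε * δ e := by
          have hlin : ∀ x, G.netOutflow (fun e => f e + ε * δ e) x = G.netOutflow f x := fun x => by
            have := hnet x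
            rw [netOutflow_eq_sum] at this ⊢
            simp only [add_mul, Finset.sum_add_distrib, mul_assoc, ← Finset.mul_sum, this]
            rw [netOutflow_eq_sum, mul_zero, add_zero]
          exact ⟨hε, fun x h₁ h₂ => (hlin x).trans (hf.conservation x h₁ h₂),
            (hlin s).trans hf.value⟩
        have hexp : Φ (fun e => f e + ε * δ e) = Φ f + ε * (c₁ + ε * c₂) := by
          simp only [Φ, hc₁, hc₂, Finset.mul_sum, ← Finset.sum_add_distrib]
          exact Finset.sum_congr rfl fun e _ => by ring
        have := hmin' _ hfeas
        rw [hexp] at this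
        exact nonneg_of_mul_nonneg_right (by linarith) hε0
      have hlim : Filter.Tendsto (fun ε : ℝ => c₁ + ε * c₂) (nhdsWithin 0 (Set.Ioi 0))
          (nhds (c₁ + 0 * c₂)) :=
        ((by fun_prop : Continuous fun ε : ℝ => c₁ + ε * c₂).tendsto 0).mono_left
          nhdsWithin_le_nhds
      simpa using ge_of_tendsto hlim hev
    have hdelay : ∀ p : List E, pathDelay l f p = ∑ e, (p.count e : ℝ) * (a e * f e + b e) :=
      fun p => by simp [sum_count_mul, pathDelay, hl _ _ (hf.nonneg _)]
    rw [hdelay, hdelay, ← sub_nonneg, ← Finset.sum_sub_distrib]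
    exact hc₁nn.trans_eq (Finset.sum_congr rfl fun e _ => by simp only [δ]; ring)
  refine ⟨f, ⟨hf, fun P Q hP hQ => key s t P Q hP.1 hQ.1⟩, fun v p hp hpos => ?_⟩
  have hle := key v v p [] hp (IsWalk.nil v) hpos
  cases p with
  | nil => rfl
  | cons e p =>
    have hpos' := List.forall_mem_cons.1 hpos
    have h₁ : 0 < l e (f e) := by
      rw [hl e _ (hf.nonneg e)]
      exact add_pos_of_pos_of_nonneg (mul_pos (ha e) hpos'.1) (hb e)
    have h₂ : 0 ≤ (p.map fun e => l e (f e)).sum := List.sum_nonneg (by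
      simp only [List.mem_map, forall_exists_index, and_imp, forall_apply_eq_imp_iff₂]
      intro e' _
      rw [hl e' _ (hf.nonneg e')]
      exact add_nonneg (mul_nonneg (ha e').le (hf.nonneg e')) (hb e'))
    simp only [pathDelay, List.map_cons, List.sum_cons, List.map_nil, List.sum_nil] at hle
    linarith

theorem isEquilibriumFlow_equilibriumFlow {l : E → ℝ → ℝ} {U : ℝ}
    (hl : ∀ e, IsStandardLinear U (l e)) {g : E → ℝ} (hg : G.IsFeasibleFlow s t d g)
    (τ : E → ℝ≥0) :
    G.IsEquilibriumFlow s t d (tolled l τ) (G.equilibriumFlow s t d l τ) := by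
  choose a b ha _ hb hlin using hl
  exact Classical.epsilon_spec (exists_isEquilibriumFlow (a := a) (b := fun e => b e + τ e) ha
    (fun e => add_nonneg (hb e).2.1 (τ e).2)
    (fun e x hx => by rw [tolled, hlin e x hx, add_assoc]) hg)

/-! ### Potentials and feasible flows -/

variable [Fintype V]

theorem sum_mul_netOutflow (G : Network V E) (f : E → ℝ) (y : V → ℝ) :
    ∑ v, y v * G.netOutflow f v = ∑ e, f e * (y (G.src e) - y (G.tgt e)) := by
  simp_rw [netOutflow_eq_sum, Finset.mul_sum]
  rw [Finset.sum_comm]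
  refine Finset.sum_congr rfl fun e _ => ?_
  simp_rw [mul_left_comm _ (f e), ← Finset.mul_sum]
  simp [mul_sub]

/-- The cost of a flow of value `d` under the differences of a potential depends only on `d`. -/
theorem IsFeasibleFlow.sum_mul_potential {f : E → ℝ} (hf : G.IsFeasibleFlow s t d f)
    (y : V → ℝ) : ∑ e, f e * (y (G.src e) - y (G.tgt e)) = d * (y s - y t) := by
  have h := G.sum_mul_netOutflow f fun v => y v - y t
  simp only [sub_sub_sub_cancel_right] at h
  -- after the shift by `y t`, only the node `s` contributes, also when `s = t`
  rw [← h, Finset.sum_eq_single s, hf.value, mul_comm]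
  · intro v _ hv
    by_cases hvt : v = t
    · simp [hvt]
    · simp [hf.conservation v hv hvt]
  · simp

/-- Complementary slackness: a flow is cheapest for the costs `c` if some potential is dual
feasible and tight on every edge that carries flow. -/
theorem IsFeasibleFlow.sum_mul_sub_nonneg {f g : E → ℝ} (hf : G.IsFeasibleFlow s t d f)
    (hg : G.IsFeasibleFlow s t d g) {c : E → ℝ} {y : V → ℝ}
    (hle : ∀ e, y (G.tgt e) - y (G.src e) ≤ c e)
    (heq : ∀ e, 0 < f e → c e ≤ y (G.tgt e) - y (G.src e)) :
    0 ≤ ∑ e, c e * (g e - f e) := by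
  have h₁ := hf.sum_mul_potential y
  have h₂ := hg.sum_mul_potential y
  have h₃ : ∑ e, g e * (y (G.tgt e) - y (G.src e)) ≤ ∑ e, g e * c e :=
    Finset.sum_le_sum fun e _ => mul_le_mul_of_nonneg_left (hle e) (hg.nonneg e)
  have h₄ : ∑ e, f e * c e ≤ ∑ e, f e * (y (G.tgt e) - y (G.src e)) :=
    Finset.sum_le_sum fun e _ => by
      rcases (hf.nonneg e).eq_or_lt with h | h
      · simp [← h]
      · exact mul_le_mul_of_nonneg_left (heq e h) h.le
  simp only [mul_sub, Finset.sum_sub_distrib] at h₁ h₂ h₃ h₄ ⊢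
  simp only [mul_comm (c _)]
  linarith

/-- The nodes from which the tail of a flow-carrying edge can be reached along flow form a set that
no flow enters. If it avoided `s`, no flow could leave it either, and the edge would close a
cycle. -/
theorem IsFeasibleFlow.exists_walk_from_source {f : E → ℝ} (hf : G.IsFeasibleFlow s t d f)
    (hd : 0 ≤ d) (hac : G.IsAcyclicFlow f) {e : E} (he : 0 < f e) :
    ∃ p, G.IsWalk s p (G.src e) ∧ ∀ e' ∈ p, 0 < f e' := by
  classical
  by_contra hs
  let X : V → Prop := fun v => ∃ p, G.IsWalk v p (G.src e) ∧ ∀ e' ∈ p, 0 < f e'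
  have hXe : X (G.src e) := ⟨[], IsWalk.nil _, by simp⟩
  have hXt : ¬ X (G.tgt e) := by
    rintro ⟨p, hp, hpos⟩
    simpa using hac _ _ (IsWalk.cons e p _ hp) (List.forall_mem_cons.2 ⟨he, hpos⟩)
  have key := hf.sum_mul_potential fun v => if X v then 1 else 0
  have hlt : 0 < ∑ e, f e * ((if X (G.src e) then 1 else 0) - if X (G.tgt e) then 1 else 0) := by
    refine Finset.sum_pos' (fun e' _ => ?_) ⟨e, Finset.mem_univ _, by simpa [hXe, hXt] using he⟩
    rcases (hf.nonneg e').eq_or_lt with h | h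
    · simp [← h]
    · have himp : X (G.tgt e') → X (G.src e') := fun ⟨p, hp, hpos⟩ =>
        ⟨e' :: p, IsWalk.cons e' p _ hp, List.forall_mem_cons.2 ⟨h, hpos⟩⟩
      refine mul_nonneg h.le ?_
      split_ifs <;> simp_all
  have hle : d * ((if X s then 1 else 0) - if X t then 1 else 0) ≤ 0 := by
    refine mul_nonpos_of_nonneg_of_nonpos hd ?_
    rw [if_neg hs]
    split_ifs <;> simp
  linarith

theorem IsFeasibleFlow.exists_walk_to_sink {f : E → ℝ} (hf : G.IsFeasibleFlow s t d f)
    (hd : 0 ≤ d) (hac : G.IsAcyclicFlow f) {e : E} (he : 0 < f e) :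
    ∃ p, G.IsWalk (G.tgt e) p t ∧ ∀ e' ∈ p, 0 < f e' := by
  classical
  by_contra ht
  let X : V → Prop := fun v => ∃ p, G.IsWalk (G.tgt e) p v ∧ ∀ e' ∈ p, 0 < f e'
  have hXe : X (G.tgt e) := ⟨[], IsWalk.nil _, by simp⟩
  have hXs : ¬ X (G.src e) := by
    rintro ⟨p, hp, hpos⟩
    simpa using hac _ _ (IsWalk.cons e p _ hp) (List.forall_mem_cons.2 ⟨he, hpos⟩)
  have key := hf.sum_mul_potential fun v => if X v then 0 else 1
  have hlt : 0 < ∑ e, f e * ((if X (G.src e) then 0 else 1) - if X (G.tgt e) then 0 else 1) := by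
    refine Finset.sum_pos' (fun e' _ => ?_) ⟨e, Finset.mem_univ _, by simpa [hXe, hXs] using he⟩
    rcases (hf.nonneg e').eq_or_lt with h | h
    · simp [← h]
    · have himp : X (G.src e') → X (G.tgt e') := fun ⟨p, hp, hpos⟩ =>
        ⟨p ++ [e'], hp.append (G.isWalk_singleton e'), List.forall_mem_append.2 ⟨hpos, by simpa⟩⟩
      refine mul_nonneg h.le ?_
      split_ifs <;> simp_all
  have hle : d * ((if X s then 0 else 1) - if X t then 0 else 1) ≤ 0 := by
    refine mul_nonpos_of_nonneg_of_nonpos hd ?_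
    rw [if_neg ht]
    split_ifs <;> simp
  linarith

/-! ### Costs for which an acyclic flow is cheapest -/

theorem exists_costs_minimized_by {f : E → ℝ} (hf : G.IsFeasibleFlow s t d f)
    (hac : G.IsAcyclicFlow f) {M : ℝ} (hM : 0 ≤ M) :
    ∃ c : E → ℝ, (∀ e, M ≤ c e) ∧
      ∀ g, G.IsFeasibleFlow s t d g → 0 ≤ ∑ e, c e * (g e - f e) := by
  classical
  -- the number of nodes reachable along flow strictly decreases along flow
  let R : V → Finset V := fun v =>
    Finset.univ.filter fun x => ∃ p, G.IsWalk v p x ∧ ∀ e ∈ p, 0 < f e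
  let y : V → ℝ := fun v => -(M * (R v).card)
  refine ⟨fun e => max M (y (G.tgt e) - y (G.src e)), fun e => le_max_left _ _, fun g hg =>
    hf.sum_mul_sub_nonneg hg (y := y) (fun e => le_max_right _ _) fun e he => ?_⟩
  have hlt : (R (G.tgt e)).card < (R (G.src e)).card := by
    refine Finset.card_lt_card (Finset.ssubset_iff_of_subset ?_ |>.2 ⟨G.src e, ?_, ?_⟩)
    · intro x hx
      obtain ⟨p, hp, hpos⟩ := (Finset.mem_filter.1 hx).2
      exact Finset.mem_filter.2 ⟨Finset.mem_univ _, e :: p, IsWalk.cons e p _ hp,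
        List.forall_mem_cons.2 ⟨he, hpos⟩⟩
    · exact Finset.mem_filter.2 ⟨Finset.mem_univ _, [], IsWalk.nil _, by simp⟩
    · intro hx
      obtain ⟨p, hp, hpos⟩ := (Finset.mem_filter.1 hx).2
      simpa using hac _ _ (IsWalk.cons e p _ hp) (List.forall_mem_cons.2 ⟨he, hpos⟩)
  have hlt' : ((R (G.tgt e)).card : ℝ) + 1 ≤ (R (G.src e)).card := by exact_mod_cast hlt
  refine max_le ?_ le_rfl
  have := mul_le_mul_of_nonneg_left hlt' hM
  simp only [y]
  linarith

/-! ### The variational inequality -/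

/-- An acyclic Wardrop equilibrium is a cheapest flow for its own delays. The potential is the
distance from `s`, capped by the sum of all delays so that it is finite at nodes which cannot be
reached. -/
theorem IsEquilibriumFlow.variational_inequality {l : E → ℝ → ℝ} {f g : E → ℝ}
    (hf : G.IsEquilibriumFlow s t d l f) (hg : G.IsFeasibleFlow s t d g) (hd : 0 ≤ d)
    (hl : ∀ e, 0 ≤ l e (f e)) : 0 ≤ ∑ e, l e (f e) * (g e - f e) := by
  classical
  have hff := hf.wardrop.feasible
  set B : ℝ := ∑ e, l e (f e)
  let D : V → Set ℝ := fun v => {x | x = B ∨ ∃ q, G.IsWalk s q v ∧ pathDelay l f q = x}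
  have hnn : ∀ q, 0 ≤ pathDelay l f q := fun q =>
    List.sum_nonneg (by simpa using fun e _ => hl e)
  have hbdd : ∀ v, BddBelow (D v) := by
    refine fun v => ⟨0, ?_⟩
    rintro x (rfl | ⟨q, -, rfl⟩)
    · exact Finset.sum_nonneg fun e _ => hl e
    · exact hnn q
  have hB : ∀ v, B ∈ D v := fun v => Or.inl rfl
  have happ : ∀ p q, pathDelay l f (p ++ q) = pathDelay l f p + pathDelay l f q := by
    simp [pathDelay]
  have hsingle : ∀ e, pathDelay l f [e] = l e (f e) := by simp [pathDelay]
  refine hff.sum_mul_sub_nonneg hg (y := fun v => sInf (D v)) (fun e => ?_) fun e he => ?_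
  · rw [sub_le_iff_le_add', ← sub_le_iff_le_add]
    refine le_csInf ⟨B, hB _⟩ ?_
    rintro x (rfl | ⟨q, hq, rfl⟩)
    · linarith [csInf_le (hbdd (G.tgt e)) (hB _), hl e]
    · have := csInf_le (hbdd (G.tgt e))
        (Or.inr ⟨q ++ [e], hq.append (G.isWalk_singleton e), happ _ _⟩)
      rw [hsingle] at this
      linarith
  · obtain ⟨p, hp, hppos⟩ := hff.exists_walk_from_source hd hf.acyclic he
    obtain ⟨r, hr, hrpos⟩ := hff.exists_walk_to_sink hd hf.acyclic he
    have hPpos : ∀ e' ∈ p ++ ([e] ++ r), 0 < f e' := by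
      simp only [List.mem_append, List.mem_singleton]
      rintro e' (h | rfl | h)
      exacts [hppos _ h, he, hrpos _ h]
    have hP : G.IsPath s (p ++ ([e] ++ r)) t :=
      hf.acyclic.isPath (hp.append ((G.isWalk_singleton e).append hr)) hPpos
    have hsrc := csInf_le (hbdd (G.src e)) (Or.inr ⟨p, hp, rfl⟩)
    rw [le_sub_iff_add_le]
    refine le_csInf ⟨B, hB _⟩ ?_
    rintro x (rfl | ⟨q, hq, rfl⟩)
    · have hnd : (p ++ ([e] ++ r)).Nodup := (List.nodup_cons.1 hP.2).2.of_map _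
      have hle : pathDelay l f (p ++ ([e] ++ r)) ≤ B := by
        rw [pathDelay, ← List.sum_toFinset _ hnd]
        exact Finset.sum_le_sum_of_subset_of_nonneg (Finset.subset_univ _) fun e _ _ => hl e
      rw [happ, happ, hsingle] at hle
      linarith [hnn r]
    · obtain ⟨Q, hQ, hsub⟩ := (hq.append hr).exists_isPath_sublist
      have h₁ := hf.wardrop.shortest _ _ hP hQ hPpos
      have h₂ : pathDelay l f Q ≤ pathDelay l f (q ++ r) :=
        (hsub.map _).sum_le_sum fun x hx => by
            obtain ⟨e', -, rfl⟩ := List.mem_map.1 hx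
            exact hl e'
      rw [happ, happ, hsingle] at h₁
      rw [happ] at h₂
      linarith

/-- If the tolls raise the delays of `g` from `w` to `w + τ`, and the resulting equilibrium is not
`g`, then `g` is strictly more expensive than the equilibrium under the costs `w + τ`. -/
theorem IsEquilibriumFlow.sum_mul_sub_pos {l : E → ℝ → ℝ} {τ : E → ℝ≥0} {f g : E → ℝ}
    (hf : G.IsEquilibriumFlow s t d (tolled l τ) f) (hg : G.IsFeasibleFlow s t d g) (hd : 0 ≤ d)
    (hl : ∀ e x, 0 ≤ x → 0 ≤ l e x) (hmono : ∀ e, StrictMonoOn (l e) (Set.Ici 0)) (hne : f ≠ g) :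
    0 < ∑ e, (l e (g e) + τ e) * (g e - f e) := by
  have hff := hf.wardrop.feasible
  have hvi := hf.variational_inequality hg hd
    fun e => add_nonneg (hl e _ (hff.nonneg e)) (τ e).2
  refine hvi.trans_lt ?_
  obtain ⟨e₀, he₀⟩ := Function.ne_iff.1 hne
  have hlt : ∀ e, f e ≠ g e →
      tolled l τ e (f e) * (g e - f e) < (l e (g e) + τ e) * (g e - f e) := by
    intro e h
    rcases lt_or_gt_of_ne h with h | h
    · have := hmono e (hff.nonneg e) (hg.nonneg e) h
      exact mul_lt_mul_of_pos_right (by simpa [tolled] using this) (sub_pos.2 h)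
    · have := hmono e (hg.nonneg e) (hff.nonneg e) h
      exact mul_lt_mul_of_neg_right (by simpa [tolled] using this) (sub_neg.2 h)
  refine Finset.sum_lt_sum (fun e _ => ?_) ⟨e₀, Finset.mem_univ _, hlt e₀ he₀⟩
  by_cases h : f e = g e
  · simp [h]
  · exact (hlt e h).le

/-- The answer to the tolls `c₀ - c`, if it is not `g`, yields a hyperplane through `c` with the
delays of `g` strictly on its positive side. -/
theorem cut_of_equilibrium {l : E → ℝ → ℝ} {U : ℝ} (hl : ∀ e, IsStandardLinear U (l e))
    {f g : E → ℝ} (hg : G.IsFeasibleFlow s t d g) (hd : 0 ≤ d) {c₀ c : E → ℝ} (hc : c ≤ c₀)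
    (hc₀ : ∀ h, G.IsFeasibleFlow s t d h → 0 ≤ ∑ e, c₀ e * (h e - g e))
    (hf : G.IsEquilibriumFlow s t d (tolled l fun e => (c₀ e - c e).toNNReal) f) (hne : f ≠ g) :
    0 < ∑ e, (l e (g e) - c e) * (g e - f e) := by
  choose a b ha _ hb hlin using hl
  have h₁ := hf.sum_mul_sub_pos hg hd
    (fun e x hx => by
      rw [hlin e x hx]
      exact add_nonneg (mul_nonneg (ha e).le hx) (hb e).2.1)
    (fun e x hx y hy hxy => by
      rw [hlin e x hx, hlin e y hy]
      linarith [mul_lt_mul_of_pos_left hxy (ha e)]) hne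
  have h₂ := hc₀ f hf.wardrop.feasible
  have h₃ : ∑ e, (l e (g e) - c e) * (g e - f e) =
      (∑ e, (l e (g e) + ((c₀ e - c e).toNNReal : ℝ)) * (g e - f e)) +
        ∑ e, c₀ e * (f e - g e) := by
    rw [← Finset.sum_add_distrib]
    refine Finset.sum_congr rfl fun e _ => ?_
    rw [Real.coe_toNNReal _ (sub_nonneg.2 (hc e))]
    ring
  rw [h₃]
  exact add_pos_of_pos_of_nonneg h₁ h₂

end Flows

end Network

/-! ### Centerpoints and the halving algorithm -/

/-- The centerpoint theorem: some point of the convex hull of `S` is such that an open half-space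
with this point on its boundary contains at most a fraction `m / (m + 1)` of `S`, where `m` is the
dimension. The convex hulls of all larger subsets of `S` have a common point by Helly's theorem,
since any `m + 1` of these subsets share an element. -/
theorem exists_centerpoint {E : Type*} [Fintype E] {S : Finset (E → ℝ)} (hS : S.Nonempty) :
    ∃ c ∈ convexHull ℝ (S : Set (E → ℝ)), ∀ g : E → ℝ,
      (Fintype.card E + 1) * (S.filter fun w => 0 < ∑ e, (w e - c e) * g e).card ≤
        Fintype.card E * S.card := by
  classical
  set m := Fintype.card E with hm
  let F : Finset (Finset (E → ℝ)) := S.powerset.filter fun T => m * S.card < (m + 1) * T.card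
  have hinter : (⋂ T ∈ F, convexHull ℝ (T : Set (E → ℝ))).Nonempty := by
    refine Convex.helly_theorem' (𝕜 := ℝ) (fun T _ => convex_convexHull ℝ _) fun I hIF hI => ?_
    rw [Module.finrank_fintype_fun_eq_card, ← hm] at hI
    suffices h : ∃ w ∈ S, ∀ T ∈ I, w ∈ T by
      obtain ⟨w, -, hw⟩ := h
      exact ⟨w, Set.mem_iInter₂.2 fun T hT => subset_convexHull ℝ _ (hw T hT)⟩
    by_contra! hcon
    have hcover : S ⊆ I.biUnion fun T => S \ T := fun w hw => by
      obtain ⟨T, hT, hwT⟩ := hcon w hw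
      exact Finset.mem_biUnion.2 ⟨T, hT, Finset.mem_sdiff.2 ⟨hw, hwT⟩⟩
    have hcard := (Finset.card_le_card hcover).trans Finset.card_biUnion_le
    have hIne : I.Nonempty := by
      obtain ⟨w, hw⟩ := hS
      obtain ⟨T, hT, -⟩ := hcon w hw
      exact ⟨T, hT⟩
    have hsmall : ∀ T ∈ I, (m + 1) * (S \ T).card < S.card := fun T hT => by
      obtain ⟨hTS, hlt⟩ := Finset.mem_filter.1 (hIF hT)
      have := Finset.card_sdiff_add_card_eq_card (Finset.mem_powerset.1 hTS)
      nlinarith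
    have hlt : ∑ T ∈ I, (m + 1) * (S \ T).card < ∑ _T ∈ I, S.card :=
      Finset.sum_lt_sum_of_nonempty hIne hsmall
    rw [← Finset.mul_sum, Finset.sum_const, smul_eq_mul] at hlt
    have h₁ : I.card * S.card ≤ (m + 1) * S.card := Nat.mul_le_mul_right _ hI
    have h₂ := Nat.mul_le_mul_left (m + 1) hcard
    omega
  obtain ⟨c, hc⟩ := hinter
  rw [Set.mem_iInter₂] at hc
  refine ⟨c, hc S (Finset.mem_filter.2 ⟨Finset.mem_powerset_self S, ?_⟩), fun g => ?_⟩
  · have := hS.card_pos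
    linarith [add_one_mul m S.card]
  · by_contra! hlt
    have hmem := hc _ (Finset.mem_filter.2 ⟨Finset.mem_powerset.2 (Finset.filter_subset _ _), hlt⟩)
    have hconv : Convex ℝ {w : E → ℝ | 0 < ∑ e, (w e - c e) * g e} := by
      intro x hx y hy α β hα hβ hαβ
      have : ∑ e, ((α • x + β • y) e - c e) * g e =
          α * ∑ e, (x e - c e) * g e + β * ∑ e, (y e - c e) * g e := by
        rw [Finset.mul_sum, Finset.mul_sum, ← Finset.sum_add_distrib]
        refine Finset.sum_congr rfl fun e _ => ?_
        simp only [Pi.add_apply, Pi.smul_apply, smul_eq_mul]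
        linear_combination (c e * g e) * hαβ
      simp only [Set.mem_ofPred_eq, this] at hx hy ⊢
      rcases hα.eq_or_lt with rfl | hα
      · have : β = 1 := by linarith
        simpa [this] using hy
      · exact add_pos_of_pos_of_nonneg (mul_pos hα hx) (mul_nonneg hβ hy.le)
    have := convexHull_min (fun w hw => (Finset.mem_filter.1 hw).2) hconv hmem
    simp at this

/-- The halving algorithm. Tolls `toll c` are offered for points `c` of the convex hull of `S`; as
long as the answer is not `g`, it cuts off `c` from the unknown `w ∈ S`. -/
theorem exists_halving_algorithm {E : Type*} [Fintype E] (toll : (E → ℝ) → E → ℝ≥0) (g : E → ℝ)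
    (S : Finset (E → ℝ)) :
    ∃ A : TollAlgorithm E, ∀ (oracle : (E → ℝ≥0) → E → ℝ), ∀ w ∈ S,
      (∀ c ∈ convexHull ℝ (S : Set (E → ℝ)), oracle (toll c) ≠ g →
        0 < ∑ e, (w e - c e) * (g e - oracle (toll c) e)) →
      oracle (A.result oracle) = g ∧
        (A.numQueries oracle : ℝ) ≤ 1 + (Fintype.card E + 1) * Real.log S.card := by
  classical
  induction S using Finset.strongInduction with
  | H S ih =>
  rcases S.eq_empty_or_nonempty with rfl | hS
  · exact ⟨TollAlgorithm.output 0, by simp⟩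
  obtain ⟨c, hcS, hc⟩ := exists_centerpoint hS
  let S' : (E → ℝ) → Finset (E → ℝ) := fun f =>
    S.filter fun w => 0 < ∑ e, (w e - c e) * (g e - f e)
  have hS' : ∀ f, S' f ⊂ S := fun f => by
    refine (Finset.filter_subset _ _).ssubset_of_ne fun h => ?_
    have h₁ := hc fun e => g e - f e
    rw [h] at h₁
    have := hS.card_pos
    linarith [add_one_mul (Fintype.card E) S.card]
  choose A hA using fun f => ih (S' f) (hS' f)
  refine ⟨TollAlgorithm.query (toll c) fun f =>
    if f = g then TollAlgorithm.output (toll c) else A f, fun oracle w hw hcut => ?_⟩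
  have hlog : 0 ≤ Real.log S.card := Real.log_natCast_nonneg _
  by_cases hfg : oracle (toll c) = g
  · simp only [TollAlgorithm.result, TollAlgorithm.numQueries, if_pos hfg]
    exact ⟨hfg, by push_cast; nlinarith [(Fintype.card E).cast_nonneg (α := ℝ)]⟩
  simp only [TollAlgorithm.result, TollAlgorithm.numQueries, if_neg hfg]
  have hw' : w ∈ S' (oracle (toll c)) := Finset.mem_filter.2 ⟨hw, hcut c hcS hfg⟩
  obtain ⟨hres, hnum⟩ := hA (oracle (toll c)) oracle w hw' fun c' hc' =>
    hcut c' (convexHull_mono (Finset.coe_subset.2 (hS' _).1) hc')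
  refine ⟨hres, ?_⟩
  have hpos : (0 : ℝ) < (S' (oracle (toll c))).card := by
    exact_mod_cast Finset.card_pos.2 ⟨w, hw'⟩
  have hSpos : (0 : ℝ) < S.card := by exact_mod_cast hS.card_pos
  have hle : ((Fintype.card E : ℝ) + 1) * (S' (oracle (toll c))).card ≤
      Fintype.card E * S.card := by
    exact_mod_cast hc fun e => g e - oracle (toll c) e
  have hm : (0 : ℝ) < Fintype.card E + 1 := by positivity
  -- `log x ≤ x - 1` for the ratio `x` of the numbers of candidates
  have hdec := Real.log_le_sub_one_of_pos (div_pos hpos hSpos)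
  rw [Real.log_div hpos.ne' hSpos.ne'] at hdec
  have hratio : ((S' (oracle (toll c))).card : ℝ) / S.card ≤
      Fintype.card E / (Fintype.card E + 1) := by
    rw [div_le_div_iff₀ hSpos hm]
    linarith
  have hsub : (Fintype.card E : ℝ) / (Fintype.card E + 1) - 1 = -1 / (Fintype.card E + 1) := by
    field_simp
    ring
  have hstep : ((Fintype.card E : ℝ) + 1) *
      (Real.log (S' (oracle (toll c))).card - Real.log S.card) ≤ -1 := by
    have : Real.log (S' (oracle (toll c))).card - Real.log S.card ≤
        -1 / (Fintype.card E + 1) := by linarith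
    rw [le_div_iff₀ hm] at this
    linarith
  push_cast
  linarith

/-! ### The candidates for the delays of the target flow -/

/-- A vector of standard linear delay functions with parameter `U` takes at `g` one of finitely many
values: the slope and the intercept of each edge are among the `⌊U ^ 2⌋₊ + 1` numbers `k / U` in
`[0, U]`. -/
theorem exists_candidates {E : Type*} [Fintype E] (U : ℝ) (hU : 0 < U) (g : E → ℝ)
    (hg : ∀ e, IsGridValue U (g e)) :
    ∃ S : Finset (E → ℝ), S.card ≤ ((⌊U ^ 2⌋₊ + 1) ^ 2) ^ Fintype.card E ∧
      (∀ w ∈ S, ∀ e, w e ≤ U * U + U) ∧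
      ∀ l : E → ℝ → ℝ, (∀ e, IsStandardLinear U (l e)) → (fun e => l e (g e)) ∈ S := by
  classical
  let I := Finset.range (⌊U ^ 2⌋₊ + 1) ×ˢ Finset.range (⌊U ^ 2⌋₊ + 1)
  let T : E → Finset ℝ := fun e => I.image fun k => (k.1 : ℝ) / U * g e + (k.2 : ℝ) / U
  have hgrid : ∀ k : ℕ, k ∈ Finset.range (⌊U ^ 2⌋₊ + 1) ↔ (k : ℝ) / U ≤ U := fun k => by
    rw [Finset.mem_range, Nat.lt_succ_iff, Nat.le_floor_iff (sq_nonneg U), div_le_iff₀ hU, sq]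
  refine ⟨Fintype.piFinset T, ?_, fun w hw e => ?_, fun l hl => ?_⟩
  · rw [Fintype.card_piFinset]
    refine Finset.prod_le_pow_card _ _ _ fun e _ => Finset.card_image_le.trans_eq ?_
    rw [Finset.card_product, Finset.card_range, pow_two (_ + 1)]
  · obtain ⟨k, hk, hkw⟩ := Finset.mem_image.1 (Fintype.mem_piFinset.1 hw e)
    obtain ⟨h₁, h₂⟩ := Finset.mem_product.1 hk
    rw [← hkw]
    exact add_le_add (mul_le_mul ((hgrid _).1 h₁) (hg e).2.2 (hg e).2.1 hU.le) ((hgrid _).1 h₂)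
  · refine Fintype.mem_piFinset.2 fun e => ?_
    obtain ⟨a, b, -, ⟨⟨i, rfl⟩, -, hi⟩, ⟨⟨j, rfl⟩, -, hj⟩, hlin⟩ := hl e
    exact Finset.mem_image.2 ⟨(i, j),
      Finset.mem_product.2 ⟨(hgrid i).2 hi, (hgrid j).2 hj⟩, (hlin _ (hg e).2.1).symm⟩

/-- A standard linear delay function forces `1 ≤ U`, since its slope is at least `1 / U`. -/
theorem IsStandardLinear.one_le {U : ℝ} (hU : 0 < U) {l : ℝ → ℝ} (hl : IsStandardLinear U l) :
    1 ≤ U := by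
  obtain ⟨a, b, ha, ⟨⟨k, rfl⟩, -, hk⟩, -⟩ := hl
  have hk0 : (1 : ℝ) ≤ k := by
    rcases Nat.eq_zero_or_pos k with rfl | h
    · simp at ha
    · exact_mod_cast h
  rw [div_le_iff₀ hU] at hk
  nlinarith

theorem query_bound {m : ℕ} (hm : 1 ≤ m) {U : ℝ} (hU : 1 ≤ U) {n : ℕ} (hn : 1 ≤ n)
    (hle : n ≤ ((⌊U ^ 2⌋₊ + 1) ^ 2) ^ m) :
    1 + ((m : ℝ) + 1) * Real.log n ≤ 9 * (m : ℝ) ^ 2 * Real.log (3 * m * U) := by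
  have hm' : (1 : ℝ) ≤ m := by exact_mod_cast hm
  have hmU : 1 ≤ m * U := by nlinarith
  set L := Real.log (3 * m * U)
  have hL : 1 ≤ L := by
    rw [Real.le_log_iff_exp_le (by positivity)]
    linarith [Real.exp_one_lt_d9]
  have hfloor : ((⌊U ^ 2⌋₊ : ℝ) + 1) ≤ (3 * m * U) ^ 2 := by
    have h₁ : (⌊U ^ 2⌋₊ : ℝ) ≤ U ^ 2 := Nat.floor_le (sq_nonneg U)
    have h₂ : U ≤ m * U := by nlinarith
    nlinarith
  have hlog : Real.log n ≤ 4 * m * L := by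
    have hn' : (n : ℝ) ≤ ((((3 * m * U) ^ 2) ^ 2) ^ m : ℝ) := by
      refine le_trans (by exact_mod_cast hle) (pow_le_pow_left₀ (by positivity)
        (pow_le_pow_left₀ (by positivity) hfloor 2) m)
    refine (Real.log_le_log (by exact_mod_cast hn) hn').trans_eq ?_
    rw [Real.log_pow, Real.log_pow, Real.log_pow]
    push_cast
    ring
  have h₁ : ((m : ℝ) + 1) * Real.log n ≤ (2 * m) * (4 * m * L) :=
    mul_le_mul (by linarith) hlog (Real.log_natCast_nonneg n) (by linarith)
  have h₂ : 1 ≤ (m : ℝ) ^ 2 * L := one_le_mul_of_one_le_of_one_le (one_le_pow₀ hm') hL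
  linarith

/-! ### The query bound -/

theorem mainTheorem4 :
    ∃ C : ℝ, ∀ (V : Type*) (E : Type*) [Fintype V] [DecidableEq V] [Fintype E]
      (G : Network V E) (s t : V) (d U : ℝ) (fstar : E → ℝ),
      0 ≤ d → 0 < U →
      G.IsFeasibleFlow s t d fstar → G.IsAcyclicFlow fstar → (∀ e, IsGridValue U (fstar e)) →
      ∃ A : TollAlgorithm E, ∀ l : E → ℝ → ℝ, (∀ e, IsStandardLinear U (l e)) →
        G.Enforces s t d l (A.result (G.equilibriumFlow s t d l)) fstar ∧
        (A.numQueries (G.equilibriumFlow s t d l) : ℝ) ≤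
          C * (Fintype.card E : ℝ) ^ 2 * Real.log (3 * Fintype.card E * U) := by
  refine ⟨9, fun V E _ _ _ G s t d U fstar hd hU hfeas hac hgrid => ?_⟩
  have henf : ∀ l : E → ℝ → ℝ, (∀ e, IsStandardLinear U (l e)) → ∀ τ,
      G.equilibriumFlow s t d l τ = fstar → G.Enforces s t d l τ fstar := fun l hl τ h =>
    ⟨h ▸ Network.isEquilibriumFlow_equilibriumFlow hl hfeas τ, congrFun h⟩
  rcases isEmpty_or_nonempty E with hE | ⟨⟨e₀⟩⟩
  -- without edges there is only one flow, and no query is allowed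
  · exact ⟨TollAlgorithm.output 0, fun l hl =>
      ⟨henf l hl _ (Subsingleton.elim _ _), by simp [TollAlgorithm.numQueries]⟩⟩
  obtain ⟨S, hcard, hbound, hmem⟩ := exists_candidates U hU fstar hgrid
  obtain ⟨c₀, hc₀M, hc₀⟩ :=
    Network.exists_costs_minimized_by hfeas hac (M := U * U + U) (by positivity)
  obtain ⟨A, hA⟩ := exists_halving_algorithm (fun c e => (c₀ e - c e).toNNReal) fstar S
  refine ⟨A, fun l hl => ?_⟩
  -- convex combinations of candidates stay below `c₀`, so that no toll is truncated
  have hhull : convexHull ℝ (S : Set (E → ℝ)) ⊆ Set.Iic c₀ :=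
    convexHull_min (fun w hw e => (hbound w hw e).trans (hc₀M e)) (convex_Iic c₀)
  obtain ⟨hres, hnum⟩ := hA (G.equilibriumFlow s t d l) _ (hmem l hl) fun c hc hne =>
    Network.cut_of_equilibrium hl hfeas hd (hhull hc) hc₀
      (Network.isEquilibriumFlow_equilibriumFlow hl hfeas _) hne
  exact ⟨henf l hl _ hres, hnum.trans (query_bound (Fintype.card_pos_iff.2 ⟨e₀⟩)
    ((hl e₀).one_le hU) (Finset.card_pos.2 ⟨_, hmem l hl⟩) hcard)⟩
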